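/- A digraph is a non-empty vertex set with an irreflexive, antisymmetric edge relation (no loops, and never both $xy$ and $yx$ are edges). It is connected if its underlying undirected graph is connected, locally finite if every vertex has only finitely many neighbours, and C-homogeneous if every isomorphism between two finite connected induced subdigraphs extends to an automorphism of the whole digraph. For a vertex $x$, $N^+(x)=\{y : xy \text{ is an edge}\}$ and $N^-(x)=\{y : yx \text{ is an edge}\}$, regarded as induced subdigraphs. $C_3$ is the directed cycle of length $3$, $\bar K_n$ is the digraph on $n$ vertices without edges, and $D[D']$ is the lexicographic product: its vertex set is $VD\times VD'$, and $(x,y)(x',y')$ is an edge if and only if $xx'\in ED$, or $x=x'$ and $yy'\in ED'$. Let $H$ be Lachlan's exceptional finite homogeneous digraph on $8$ vertices: its vertices are $s,t,u_i,l_i$ $(i\in\mathbb Z/3)$ and its edges are $su_i,\ u_it,\ tl_i,\ l_is,\ u_iu_{i+1},\ l_il_{i+1},\ l_iu_i,\ u_il_{i+1}$ for $i\in\mathbb Z/3$ (equivalently, $H$ is isomorphic to the digraph on $\mathbb F_3^2\setminus\{0\}$ with an edge from $v$ to $w$ whenever $\det(v,w)=1$). **Lemma 3.9.** Let $D$ be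 a connected locally finite C-homogeneous digraph, let $x\in VD$ and let $n\ge 1$ be an integer. If $N^+(x)\cong C_3[\bar K_n]$ or $N^-(x)\cong C_3[\bar K_n]$, then $D\cong H[\bar K_n]$. -/

import Mathlib

namespace Digraph

/-- The edge relation is asymmetric (equivalently, irreflexive and antisymmetric):
there are no loops and no edge is present in both directions. -/
def Asymmetric {V : Type*} (D : Digraph V) : Prop :=
  ∀ x y : V, D.Adj x y → ¬ D.Adj y x

/-- The out-neighbourhood of `x`. -/
def outNbhd {V : Type*} (D : Digraph V) (x : V) : Set V := {y | D.Adj x y}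

/-- The in-neighbourhood of `x`. -/
def inNbhd {V : Type*} (D : Digraph V) (x : V) : Set V := {y | D.Adj y x}

/-- Every vertex has only finitely many neighbours. -/
def IsLocallyFinite {V : Type*} (D : Digraph V) : Prop :=
  ∀ x : V, (D.outNbhd x ∪ D.inNbhd x).Finite

/-- A digraph is connected if its underlying undirected graph is connected
(in particular, it has a vertex). -/
def IsConnected {V : Type*} (D : Digraph V) : Prop :=
  D.toSimpleGraphInclusive.Connected

/-- The subdigraph induced by the vertex set `A`. -/
def inducedOn {V : Type*} (D : Digraph V) (A : Set V) : Digraph A where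
  Adj a b := D.Adj a b

/-- Isomorphisms of digraphs: bijections of the vertex sets that preserve and reflect edges. -/
abbrev Iso {V W : Type*} (D : Digraph V) (E : Digraph W) : Type _ := D.Adj ≃r E.Adj

/-- A digraph is C-homogeneous (connected-homogeneous) if every isomorphism between two finite
connected induced subdigraphs extends to an automorphism of the whole digraph. -/
def IsCHomogeneous {V : Type*} (D : Digraph V) : Prop :=
  ∀ A B : Set V, A.Finite → B.Finite →
    (D.inducedOn A).IsConnected → (D.inducedOn B).IsConnected →
    ∀ φ : Iso (D.inducedOn A) (D.inducedOn B),
      ∃ α : Iso D D, ∀ a : A, α (a : V) = (φ a : V)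

/-- The lexicographic product `D[E]`. -/
def lexProduct {V W : Type*} (D : Digraph V) (E : Digraph W) : Digraph (V × W) where
  Adj p q := D.Adj p.1 q.1 ∨ (p.1 = q.1 ∧ E.Adj p.2 q.2)

/-- The directed cycle of length `m`. -/
def directedCycle (m : ℕ) : Digraph (ZMod m) where
  Adj i j := j = i + 1

/-- The digraph on `n` vertices without edges. -/
def edgeless (n : ℕ) : Digraph (Fin n) := Digraph.emptyDigraph (Fin n)

/-- The eight vertices of Lachlan's exceptional finite homogeneous digraph: two poles and
two triples indexed by the integers modulo 3. -/
inductive LachlanVertex : Type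
  | north : LachlanVertex
  | south : LachlanVertex
  | upper : ZMod 3 → LachlanVertex
  | lower : ZMod 3 → LachlanVertex

/-- Lachlan's exceptional finite homogeneous digraph `H` on eight vertices. Both triples are
directed triangles; `north` dominates the upper triangle, which dominates `south`, which
dominates the lower triangle, which dominates `north`; and between the triangles there are the
edges `lower i → upper i` and `upper i → lower (i + 1)`. Every vertex is non-adjacent to exactly
one other vertex. (It is isomorphic to the digraph on the nonzero vectors of the plane over the
field with three elements with an edge from `u` to `v` whenever `det (u, v) = 1`.) -/
def lachlanH : Digraph LachlanVertex where
  Adj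
    | .north, .upper _ => True
    | .upper _, .south => True
    | .south, .lower _ => True
    | .lower _, .north => True
    | .upper i, .upper j => j = i + 1
    | .lower i, .lower j => j = i + 1
    | .lower i, .upper j => j = i
    | .upper i, .lower j => j = i + 1
    | _, _ => False

end Digraph

/-!
Reversing edges if necessary, we may assume that all out-neighbourhoods are `C₃[K̄ₙ]`. Homogeneity
of edges and of in-forks (two non-adjacent vertices with a common out-neighbour) forces the parts
of these out-neighbourhoods to be the classes of vertices with the same neighbours. Hence `D` is
`Q[K̄ₙ]` for its quotient `Q` by these twin classes, and `Q` is again C-homogeneous, with directed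
triangles as out-neighbourhoods.

In `Q`, homogeneity of edges, in-forks and triangles shows that every triangle has a common
in-neighbour and a common out-neighbour, and that each edge `v → w` starts a triangle dominating
`w`. Let `y` be the triangle of out-neighbours of `x`, and `t` a common out-neighbour of `y`. The
triangles dominating `y i` that start with `x` provide the three remaining vertices of a
homomorphic image of `H`. The homomorphism maps out-neighbourhoods onto out-neighbourhoods, and
since every edge lies in a directed cycle, connectedness makes it surjective.
-/

namespace LachlanDigraph

open Digraph Relation

variable {V W ι : Type*} {D : Digraph V} {E : Digraph W}

/-! ### Connectedness -/

theorem isConnected_iff_eqvGen :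
    D.IsConnected ↔ Nonempty V ∧ ∀ u v, EqvGen D.Adj u v := by
  have hreach : ∀ u v, D.toSimpleGraphInclusive.Reachable u v ↔ EqvGen D.Adj u v := by
    refine fun u v => ⟨fun h => ?_, fun h => ?_⟩
    · obtain ⟨p⟩ := h
      induction p with
      | nil => exact .refl _
      | cons h _ ih => exact .trans _ _ _ (h.2.elim (.rel _ _) fun h => .symm _ _ (.rel _ _ h)) ih
    · induction h with
      | rel u v h =>
        obtain rfl | hne := eq_or_ne u v
        · rfl
        · exact SimpleGraph.Adj.reachable ⟨hne, .inl h⟩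
      | refl => rfl
      | symm _ _ _ ih => exact ih.symm
      | trans _ _ _ _ _ ih₁ ih₂ => exact ih₁.trans ih₂
  rw [Digraph.IsConnected, SimpleGraph.connected_iff, and_comm]
  exact and_congr_right fun _ => forall₂_congr hreach

theorem isConnected_of_surjective (hD : D.IsConnected) (g : D.Adj →r E.Adj)
    (hg : Function.Surjective g) : E.IsConnected := by
  rw [isConnected_iff_eqvGen] at hD ⊢
  refine ⟨hD.1.map g, hg.forall₂.2 fun u v => ?_⟩
  induction hD.2 u v with
  | rel _ _ h => exact .rel _ _ (g.map_rel h)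
  | refl => exact .refl _
  | symm _ _ _ ih => exact .symm _ _ ih
  | trans _ _ _ _ _ ih₁ ih₂ => exact .trans _ _ _ ih₁ ih₂

theorem eq_univ_of_outClosed (hD : D.IsConnected)
    (hcyc : ∀ u v, D.Adj u v → ReflTransGen D.Adj v u) {S : Set V} (hS : S.Nonempty)
    (hout : ∀ u ∈ S, ∀ v, D.Adj u v → v ∈ S) : S = Set.univ := by
  have hpath : ∀ {u v}, ReflTransGen D.Adj u v → u ∈ S → v ∈ S := fun h hu => by
    induction h with
    | refl => exact hu
    | tail _ h ih => exact hout _ ih _ h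
  have hiff (u v : V) : u ∈ S ↔ v ∈ S := by
    induction (isConnected_iff_eqvGen.1 hD).2 u v with
    | rel _ _ h => exact ⟨fun hu => hout _ hu _ h, hpath (hcyc _ _ h)⟩
    | refl => rfl
    | symm _ _ _ ih => exact ih.symm
    | trans _ _ _ _ _ ih₁ ih₂ => exact ih₁.trans ih₂
  obtain ⟨u, hu⟩ := hS
  exact Set.eq_univ_of_forall fun v => (hiff u v).1 hu

/-! ### Homogeneity -/

theorem exists_aut_of_embeddings [Finite W] (hD : D.IsCHomogeneous) (hE : E.IsConnected)
    (f g : E.Adj ↪r D.Adj) : ∃ α : Iso D D, ∀ i, α (f i) = g i := by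
  let toRange (h : E.Adj ↪r D.Adj) : Iso E (D.inducedOn (Set.range h)) :=
    ⟨Equiv.ofInjective h h.injective, h.map_rel_iff⟩
  have hconn (h : E.Adj ↪r D.Adj) : (D.inducedOn (Set.range h)).IsConnected :=
    isConnected_of_surjective hE (toRange h).toRelEmbedding.toRelHom (toRange h).surjective
  obtain ⟨α, hα⟩ := hD _ _ (Set.finite_range f) (Set.finite_range g) (hconn f) (hconn g)
    ((toRange f).symm.trans (toRange g))
  refine ⟨α, fun i => (hα (toRange f i)).trans ?_⟩
  rw [RelIso.trans_apply, RelIso.symm_apply_apply]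
  rfl

section

variable (ha : D.Asymmetric) (hD : D.IsCHomogeneous)

include ha

theorem not_adj_self (x : V) : ¬ D.Adj x x := fun hx => ha x x hx hx

theorem ne_of_adj {x y : V} (h : D.Adj x y) : x ≠ y := by
  rintro rfl
  exact not_adj_self ha _ h

include hD

/-- A homomorphism from a trichotomous relation to an asymmetric one is an embedding. -/
theorem exists_aut_of_trichotomous [Finite ι] [Nonempty ι] (r : ι → ι → Prop) [Std.Trichotomous r]
    {f g : ι → V} (hf : ∀ i j, r i j → D.Adj (f i) (f j)) (hg : ∀ i j, r i j → D.Adj (g i) (g j)) :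
    ∃ α : Iso D D, ∀ i, α (f i) = g i := by
  have : Std.Asymm D.Adj := ⟨ha⟩
  have hconn : IsConnected ⟨r⟩ := isConnected_iff_eqvGen.2 ⟨inferInstance, fun i j => by
    rcases trichotomous_of r i j with h | rfl | h
    · exact .rel _ _ h
    · exact .refl _
    · exact .symm _ _ (.rel _ _ h)⟩
  exact exists_aut_of_embeddings hD hconn (.ofMonotone f hf) (.ofMonotone g hg)

theorem exists_aut_vertex (a b : V) : ∃ α : Iso D D, α a = b := by
  obtain ⟨α, hα⟩ := exists_aut_of_trichotomous ha hD (fun _ _ : Unit => False)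
    (f := fun _ => a) (g := fun _ => b) (fun _ _ => False.elim) (fun _ _ => False.elim)
  exact ⟨α, hα ()⟩

theorem exists_aut_edge {a b a' b' : V} (h : D.Adj a b) (h' : D.Adj a' b') :
    ∃ α : Iso D D, α a = a' ∧ α b = b' := by
  have hom {a b : V} (h : D.Adj a b) (i j : Fin 2) (hij : i < j) :
      D.Adj (![a, b] i) (![a, b] j) := by
    obtain ⟨rfl, rfl⟩ : i = 0 ∧ j = 1 := by omega
    exact h
  obtain ⟨α, hα⟩ := exists_aut_of_trichotomous ha hD (· < ·) (hom h) (hom h')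
  exact ⟨α, hα 0, hα 1⟩

end

/-- Two vertices `a ≠ b` that are not adjacent and have the common out-neighbour `c`. -/
structure IsInFork (D : Digraph V) (a b c : V) : Prop where
  left : D.Adj a c
  right : D.Adj b c
  ne : a ≠ b
  not_adj : ¬ D.Adj a b
  not_adj' : ¬ D.Adj b a

/-- The in-fork on three vertices, whose edges are `0 → 2` and `1 → 2`. -/
def inFork : Digraph (Fin 3) where
  Adj i j := i ≠ 2 ∧ j = 2

theorem isConnected_inFork : inFork.IsConnected := by
  have hcentre (i : Fin 3) : EqvGen inFork.Adj i 2 := by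
    obtain rfl | hi := eq_or_ne i 2
    · exact .refl _
    · exact .rel _ _ ⟨hi, rfl⟩
  exact isConnected_iff_eqvGen.2 ⟨inferInstance, fun i j =>
    .trans _ _ _ (hcentre i) (.symm _ _ (hcentre j))⟩

theorem IsInFork.exists_embedding (ha : D.Asymmetric) {a b c : V} (h : IsInFork D a b c) :
    ∃ f : inFork.Adj ↪r D.Adj, ⇑f = ![a, b, c] := by
  refine ⟨⟨⟨![a, b, c], fun i j hij => ?_⟩, fun {i j} => ?_⟩, rfl⟩
  · fin_cases i <;> fin_cases j <;>
      simp_all [h.ne, h.ne.symm, ne_of_adj ha h.left, ne_of_adj ha h.right,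
        (ne_of_adj ha h.left).symm, (ne_of_adj ha h.right).symm]
  · change D.Adj (![a, b, c] i) (![a, b, c] j) ↔ i ≠ 2 ∧ j = 2
    fin_cases i <;> fin_cases j <;>
      simp [not_adj_self ha, h.left, h.right, h.not_adj, h.not_adj', ha _ _ h.left,
        ha _ _ h.right]

theorem exists_aut_inFork (ha : D.Asymmetric) (hD : D.IsCHomogeneous) {a b c a' b' c' : V}
    (h : IsInFork D a b c) (h' : IsInFork D a' b' c') :
    ∃ α : Iso D D, α a = a' ∧ α b = b' ∧ α c = c' := by
  obtain ⟨f, hf⟩ := h.exists_embedding ha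
  obtain ⟨g, hg⟩ := h'.exists_embedding ha
  obtain ⟨α, hα⟩ := exists_aut_of_embeddings hD isConnected_inFork f g
  simp only [hf, hg] at hα
  exact ⟨α, hα 0, hα 1, hα 2⟩

/-! ### Reversal and lexicographic products -/

/-- The digraph with all edges reversed. -/
def reverse (D : Digraph V) : Digraph V where
  Adj x y := D.Adj y x

theorem asymmetric_reverse (h : D.Asymmetric) : (reverse D).Asymmetric :=
  fun x y hxy hyx => h x y hyx hxy

theorem isConnected_reverse (hD : D.IsConnected) : (reverse D).IsConnected := by
  have h : (reverse D).toSimpleGraphInclusive = D.toSimpleGraphInclusive := by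
    ext x y
    exact and_congr_right fun _ => or_comm
  rwa [Digraph.IsConnected, h]

/-- An isomorphism of digraphs as an isomorphism of the reversed digraphs. -/
def reverseIso (φ : Iso D E) : Iso (reverse D) (reverse E) :=
  φ.swap

theorem isCHomogeneous_reverse (h : D.IsCHomogeneous) : (reverse D).IsCHomogeneous := by
  intro A B hA hB hcA hcB φ
  obtain ⟨α, hα⟩ := h A B hA hB (isConnected_reverse hcA) (isConnected_reverse hcB)
    (reverseIso φ)
  exact ⟨reverseIso α, hα⟩

/-- The isomorphism of lexicographic products induced by an isomorphism of the left factors. -/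
def lexProductCongrLeft (φ : Iso D E) (F : Digraph ι) : Iso (D.lexProduct F) (E.lexProduct F) where
  toEquiv := φ.toEquiv.prodCongr (.refl ι)
  map_rel_iff' := or_congr φ.map_rel_iff (and_congr_left' φ.toEquiv.apply_eq_iff_eq)

theorem lexProduct_edgeless_adj {n : ℕ} {p q : V × Fin n} :
    (D.lexProduct (edgeless n)).Adj p q ↔ D.Adj p.1 q.1 :=
  or_iff_left fun h => h.2

theorem reverse_lexProduct_edgeless (D : Digraph V) (n : ℕ) :
    reverse (D.lexProduct (edgeless n)) = (reverse D).lexProduct (edgeless n) := by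
  ext p q
  rw [lexProduct_edgeless_adj]
  exact lexProduct_edgeless_adj

/-- The directed triangle is isomorphic to its reverse. -/
def directedTriangleReverseIso : Iso (reverse (directedCycle 3)) (directedCycle 3) where
  toEquiv := .neg _
  map_rel_iff' {i j} := by
    change -j = -i + 1 ↔ i = j + 1
    revert i j; decide

/-- Lachlan's digraph is isomorphic to its reverse. -/
def lachlanHReverseIso : Iso (reverse lachlanH) lachlanH where
  toFun
    | .north => .south
    | .south => .north
    | .upper i => .upper (-i)
    | .lower i => .lower (1 - i)
  invFun
    | .north => .south
    | .south => .north
    | .upper i => .upper (-i)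
    | .lower i => .lower (1 - i)
  left_inv := by rintro (_ | _ | i | i) <;> simp
  right_inv := by rintro (_ | _ | i | i) <;> simp
  map_rel_iff' := by
    rintro (_ | _ | i | i) (_ | _ | j | j)
    case upper.upper => exact (by decide : ∀ i j : ZMod 3, -j = -i + 1 ↔ i = j + 1) i j
    case upper.lower => exact (by decide : ∀ i j : ZMod 3, 1 - j = -i + 1 ↔ i = j) i j
    case lower.upper => exact (by decide : ∀ i j : ZMod 3, -j = 1 - i ↔ i = j + 1) i j
    case lower.lower => exact (by decide : ∀ i j : ZMod 3, 1 - j = 1 - i + 1 ↔ i = j + 1) i j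
    all_goals exact Iff.rfl

/-! ### The twin quotient -/

/-- Two vertices are twins if they have the same out-neighbours and the same in-neighbours. -/
def twinSetoid (D : Digraph V) : Setoid V where
  r z w := ∀ v, (D.Adj z v ↔ D.Adj w v) ∧ (D.Adj v z ↔ D.Adj v w)
  iseqv := ⟨fun _ _ => ⟨.rfl, .rfl⟩, fun h v => ⟨(h v).1.symm, (h v).2.symm⟩,
    fun h k v => ⟨(h v).1.trans (k v).1, (h v).2.trans (k v).2⟩⟩

theorem twinSetoid_adj_congr {x y x' y' : V} (hx : twinSetoid D x x') (hy : twinSetoid D y y') :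
    D.Adj x y = D.Adj x' y' :=
  propext ((hx y).1.trans (hy x').2)

/-- The digraph of twin classes. -/
def twinQuotient (D : Digraph V) : Digraph (Quotient (twinSetoid D)) where
  Adj := Quotient.lift₂ D.Adj fun _ _ _ _ => twinSetoid_adj_congr

theorem twinQuotient_adj {x y : V} : (twinQuotient D).Adj (.mk _ x) (.mk _ y) ↔ D.Adj x y :=
  Iff.rfl

theorem asymmetric_twinQuotient (h : D.Asymmetric) : (twinQuotient D).Asymmetric := by
  rintro ⟨x⟩ ⟨y⟩
  exact h x y

theorem isConnected_twinQuotient (h : D.IsConnected) : (twinQuotient D).IsConnected :=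
  isConnected_of_surjective h ⟨Quotient.mk _, id⟩ Quotient.mk_surjective

/-- The isomorphism of twin quotients induced by an isomorphism of digraphs. -/
def twinQuotientIso (α : Iso D E) : Iso (twinQuotient D) (twinQuotient E) where
  toEquiv := Quotient.congr α.toEquiv fun z w => by
    refine Iff.trans ?_ α.surjective.forall.symm
    exact forall_congr' fun v => and_congr (iff_congr α.map_rel_iff.symm α.map_rel_iff.symm)
      (iff_congr α.map_rel_iff.symm α.map_rel_iff.symm)
  map_rel_iff' := by
    rintro ⟨x⟩ ⟨y⟩
    exact α.map_rel_iff

/-- Choosing representatives embeds finite subdigraphs of the twin quotient into `D`, and the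
automorphisms of `D` descend to the twin quotient. -/
theorem isCHomogeneous_twinQuotient (hD : D.IsCHomogeneous) :
    (twinQuotient D).IsCHomogeneous := by
  intro A B hA _ hAconn _ φ
  have : Finite A := hA
  let out : (twinQuotient D).Adj ↪r D.Adj :=
    Quotient.outRelEmbedding fun _ _ _ _ => twinSetoid_adj_congr
  let val (S) : ((twinQuotient D).inducedOn S).Adj ↪r (twinQuotient D).Adj :=
    ⟨.subtype _, .rfl⟩
  obtain ⟨α, hα⟩ := exists_aut_of_embeddings hD hAconn ((val A).trans out)
    ((φ.toRelEmbedding.trans (val B)).trans out)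
  refine ⟨twinQuotientIso α, fun a => ?_⟩
  calc twinQuotientIso α a = twinQuotientIso α (.mk _ (Quotient.out a.1)) := by rw [Quotient.out_eq]
    _ = .mk _ (Quotient.out (φ a).1) := congrArg _ (hα a)
    _ = φ a := Quotient.out_eq _

theorem nonempty_iso_twinQuotient_lexProduct {n : ℕ}
    (h : ∀ z, ∃ f : Fin n → V, Function.Injective f ∧ ∀ w, twinSetoid D w z ↔ w ∈ Set.range f) :
    Nonempty (Iso D ((twinQuotient D).lexProduct (edgeless n))) := by
  have hfib : ∀ q : Quotient (twinSetoid D), ∃ f : Fin n → V, Function.Injective f ∧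
      ∀ w, Quotient.mk _ w = q ↔ w ∈ Set.range f := by
    rintro ⟨z⟩
    obtain ⟨f, hf, hfz⟩ := h z
    exact ⟨f, hf, fun w => Quotient.eq.trans (hfz w)⟩
  choose f hf hfq using hfib
  have hmk : ∀ q i, Quotient.mk _ (f q i) = q := fun q i => (hfq q _).2 ⟨i, rfl⟩
  have hbij : Function.Bijective fun p : Quotient (twinSetoid D) × Fin n => f p.1 p.2 := by
    refine ⟨?_, fun w => ?_⟩
    · rintro ⟨q, i⟩ ⟨q', i'⟩ heq
      obtain rfl : q = q' := (hmk q i).symm.trans ((congrArg _ heq).trans (hmk q' i'))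
      exact congrArg _ (hf q heq)
    · obtain ⟨i, hi⟩ := (hfq (.mk _ w) w).1 rfl
      exact ⟨(.mk _ w, i), hi⟩
  refine ⟨RelIso.symm ⟨Equiv.ofBijective _ hbij, fun {p p'} => ?_⟩⟩
  change D.Adj (f p.1 p.2) (f p'.1 p'.2) ↔ _
  rw [lexProduct_edgeless_adj, ← twinQuotient_adj, hmk, hmk]

/-! ### Directed triangles as out-neighbourhoods -/

theorem zmod_three_cases (i j : ZMod 3) : j = i ∨ j = i + 1 ∨ j = i + 2 := by
  revert i j; decide

theorem zmod_three_add_two_add_one (i : ZMod 3) : i + 2 + 1 = i := by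
  revert i; decide

/-- The vertices `y 0`, `y 1`, `y 2` form a directed triangle, in this cyclic order. -/
def IsTriangle (D : Digraph V) (y : ZMod 3 → V) : Prop :=
  ∀ i, D.Adj (y i) (y (i + 1))

/-- The directed triangle `y` is the out-neighbourhood of `x`. -/
structure IsOutTriangle (D : Digraph V) (x : V) (y : ZMod 3 → V) : Prop where
  isTriangle : IsTriangle D y
  adj_iff : ∀ u, D.Adj x u ↔ ∃ i, y i = u

/-- All out-neighbourhoods are directed triangles. -/
def HasOutTriangles (D : Digraph V) : Prop :=
  ∀ x, ∃ y, IsOutTriangle D x y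

theorem IsTriangle.map {y : ZMod 3 → V} (hy : IsTriangle D y) (g : D.Adj →r E.Adj) :
    IsTriangle E (g ∘ y) :=
  fun i => g.map_rel (hy i)

theorem IsTriangle.adj_add_two {y : ZMod 3 → V} (hy : IsTriangle D y) (i : ZMod 3) :
    D.Adj (y (i + 2)) (y i) := by
  simpa only [zmod_three_add_two_add_one] using hy (i + 2)

theorem IsOutTriangle.adj {x : V} {y : ZMod 3 → V} (hy : IsOutTriangle D x y) (i : ZMod 3) :
    D.Adj x (y i) :=
  (hy.adj_iff _).2 ⟨i, rfl⟩

section OutTriangles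

variable (ha : D.Asymmetric) (h : HasOutTriangles D)

include h

theorem HasOutTriangles.adj_or_adj {x u v : V} (hu : D.Adj x u) (hv : D.Adj x v) (hne : u ≠ v) :
    D.Adj u v ∨ D.Adj v u := by
  obtain ⟨y, hy⟩ := h x
  obtain ⟨i, rfl⟩ := (hy.adj_iff u).1 hu
  obtain ⟨j, rfl⟩ := (hy.adj_iff v).1 hv
  rcases zmod_three_cases i j with rfl | rfl | rfl
  · exact (hne rfl).elim
  · exact .inl (hy.isTriangle i)
  · exact .inr (hy.isTriangle.adj_add_two i)

include ha

theorem HasOutTriangles.eq_of_common_out {x u v v' : V} (hu : D.Adj x u) (hv : D.Adj x v)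
    (hv' : D.Adj x v') (huv : D.Adj u v) (huv' : D.Adj u v') : v = v' := by
  obtain ⟨y, hy⟩ := h x
  obtain ⟨i, rfl⟩ := (hy.adj_iff u).1 hu
  have eq_succ {w : V} (hw : D.Adj x w) (hiw : D.Adj (y i) w) : w = y (i + 1) := by
    obtain ⟨j, rfl⟩ := (hy.adj_iff w).1 hw
    rcases zmod_three_cases i j with rfl | rfl | rfl
    · exact (not_adj_self ha _ hiw).elim
    · rfl
    · exact (ha _ _ hiw (hy.isTriangle.adj_add_two i)).elim
  rw [eq_succ hv huv, eq_succ hv' huv']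

theorem HasOutTriangles.eq_of_common_mid {x u u' v : V} (hu : D.Adj x u) (hu' : D.Adj x u')
    (hv : D.Adj x v) (huv : D.Adj u v) (hu'v : D.Adj u' v) : u = u' := by
  by_contra hne
  rcases h.adj_or_adj hu hu' hne with huu' | hu'u
  · exact ne_of_adj ha hu'v (h.eq_of_common_out ha hu hu' hv huu' huv)
  · exact ne_of_adj ha huv (h.eq_of_common_out ha hu' hu hv hu'u hu'v)

theorem HasOutTriangles.adj_of_path {x u v w : V} (hu : D.Adj x u) (hv : D.Adj x v) (hw : D.Adj x w)
    (huv : D.Adj u v) (hvw : D.Adj v w) : D.Adj w u := by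
  refine (h.adj_or_adj hw hu fun hwu => ha _ _ huv (hwu ▸ hvw)).resolve_right fun huw => ?_
  exact ne_of_adj ha hvw (h.eq_of_common_out ha hu hv hw huv huw)

theorem IsTriangle.isOutTriangle {x : V} {y : ZMod 3 → V} (hy : IsTriangle D y)
    (hx : ∀ i, D.Adj x (y i)) : IsOutTriangle D x y := by
  refine ⟨hy, fun u => ⟨fun hu => ?_, fun ⟨i, hi⟩ => hi ▸ hx i⟩⟩
  by_cases hne : y 0 = u
  · exact ⟨0, hne⟩
  rcases h.adj_or_adj (hx 0) hu hne with h0 | h0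
  · exact ⟨1, h.eq_of_common_out ha (hx 0) (hx 1) hu (hy 0) h0⟩
  · exact ⟨2, h.eq_of_common_mid ha (hx 2) hu (hx 0) (hy 2) h0⟩

variable (hD : D.IsCHomogeneous)

omit h

include hD

theorem exists_aut_triangle {y z : ZMod 3 → V} (hy : IsTriangle D y) (hz : IsTriangle D z) :
    ∃ α : Iso D D, ∀ i, α (y i) = z i := by
  have : Std.Trichotomous fun i j : ZMod 3 => j = i + 1 := ⟨by decide⟩
  exact exists_aut_of_trichotomous ha hD (fun i j => j = i + 1) (fun i _ hij => hij ▸ hy i)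
    (fun i _ hij => hij ▸ hz i)

include h

theorem HasOutTriangles.exists_triangle_of_adj {u v : V} (huv : D.Adj u v) :
    ∃ z, IsTriangle D z ∧ z 0 = u ∧ z 1 = v := by
  obtain ⟨y, hy⟩ := h u
  obtain ⟨α, hα⟩ := exists_aut_edge ha hD (hy.isTriangle 0) huv
  exact ⟨α ∘ y, hy.isTriangle.map α.toRelEmbedding.toRelHom, hα⟩

theorem HasOutTriangles.exists_common_in_of_isTriangle {z : ZMod 3 → V} (hz : IsTriangle D z) :
    ∃ x, ∀ i, D.Adj x (z i) := by
  obtain ⟨y, hy⟩ := h (z 0)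
  obtain ⟨α, hα⟩ := exists_aut_triangle ha hD hy.isTriangle hz
  exact ⟨α (z 0), fun i => hα i ▸ α.map_rel_iff.2 (hy.adj i)⟩

theorem HasOutTriangles.exists_common_in {u v : V} (huv : D.Adj u v) :
    ∃ x, D.Adj x u ∧ D.Adj x v := by
  obtain ⟨z, hz, rfl, rfl⟩ := h.exists_triangle_of_adj ha hD huv
  obtain ⟨x, hx⟩ := h.exists_common_in_of_isTriangle ha hD hz
  exact ⟨x, hx 0, hx 1⟩

/-- If `v ≠ w` both dominate the edge `p → y`, then by homogeneity the ends of every in-fork have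
a common out-neighbour dominating the tip. Comparing the in-fork `(v, w, y)` with a common
in-neighbour `u` of `v` and `y` gives a contradiction. -/
theorem HasOutTriangles.eq_of_common_in {p y v w : V} (hpy : D.Adj p y) (hvp : D.Adj v p)
    (hvy : D.Adj v y) (hwp : D.Adj w p) (hwy : D.Adj w y) : v = w := by
  by_contra hne
  have not_adj {v w : V} (hvp : D.Adj v p) (hvy : D.Adj v y) (hwp : D.Adj w p)
      (hwy : D.Adj w y) : ¬ D.Adj v w := fun hvw =>
    ne_of_adj ha hpy (h.eq_of_common_out ha hvw hvp hvy hwp hwy)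
  have hvw := not_adj hvp hvy hwp hwy
  have hwv := not_adj hwp hwy hvp hvy
  have exists_mid {a b c : V} (hf : IsInFork D a b c) :
      ∃ q, D.Adj a q ∧ D.Adj b q ∧ D.Adj q c := by
    obtain ⟨α, rfl, rfl, rfl⟩ := exists_aut_inFork ha hD ⟨hvy, hwy, hne, hvw, hwv⟩ hf
    exact ⟨α p, α.map_rel_iff.2 hvp, α.map_rel_iff.2 hwp, α.map_rel_iff.2 hpy⟩
  obtain ⟨u, huv, huy⟩ := h.exists_common_in ha hD hvy
  have huw : ¬ D.Adj u w := fun huw =>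
    hne (h.eq_of_common_mid ha huv huw huy hvy hwy)
  have hwu : ¬ D.Adj w u := fun hwu => by
    obtain rfl := h.eq_of_common_mid ha hwu hwp hwy huy hpy
    exact ha _ _ huv hvp
  obtain ⟨q, huq, hwq, hqy⟩ :=
    exists_mid ⟨huy, hwy, fun huw => hwv (huw ▸ huv), huw, hwu⟩
  obtain rfl := h.eq_of_common_mid ha huq huv huy hqy hvy
  exact hwv hwq

/-! ### Recognition of Lachlan's digraph -/

theorem HasOutTriangles.exists_common_out_of_isTriangle {y : ZMod 3 → V} (hy : IsTriangle D y) :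
    ∃ t, ∀ i, D.Adj (y i) t := by
  obtain ⟨x, hx⟩ := h.exists_common_in_of_isTriangle ha hD hy
  obtain ⟨z, hz⟩ := h (y 0)
  obtain ⟨j, hj⟩ := (hz.adj_iff (y 1)).1 (hy 0)
  set t := z (j + 1)
  have h0t : D.Adj (y 0) t := hz.adj _
  have h1t : D.Adj (y 1) t := hj ▸ hz.isTriangle j
  have h2t : D.Adj (y 2) t := by
    have hne : y 2 ≠ t := fun h2t => ha _ _ h0t (h2t ▸ hy 2)
    refine (h.adj_or_adj (hy 1) h1t hne).resolve_right fun ht2 => ?_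
    have htri : IsTriangle D (![y 0, t, y 2] : Fin 3 → V) := by
      intro i; fin_cases i
      exacts [h0t, ht2, hy 2]
    obtain ⟨x', hx'⟩ := h.exists_common_in_of_isTriangle ha hD htri
    obtain rfl : x = x' := h.eq_of_common_in ha hD (hy 2) (hx 2) (hx 0) (hx' 2) (hx' 0)
    exact ne_of_adj ha h1t (h.eq_of_common_out ha (hx 0) (hx 1) (hx' 1) (hy 0) h0t)
  refine ⟨t, fun i => ?_⟩
  fin_cases i
  exacts [h0t, h1t, h2t]

theorem HasOutTriangles.exists_triangle_forall_adj {u v : V} (huv : D.Adj u v) :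
    ∃ z, IsTriangle D z ∧ z 0 = u ∧ ∀ i, D.Adj (z i) v := by
  obtain ⟨y, hy⟩ := h u
  obtain ⟨t, ht⟩ := h.exists_common_out_of_isTriangle ha hD hy.isTriangle
  obtain ⟨α, hα, rfl⟩ := exists_aut_edge ha hD (ht 0) huv
  exact ⟨α ∘ y, hy.isTriangle.map α.toRelEmbedding.toRelHom, hα, fun i => α.map_rel_iff.2 (ht i)⟩

theorem IsOutTriangle.exists_lower {x : V} {y : ZMod 3 → V} (hy : IsOutTriangle D x y) :
    ∃ l : ZMod 3 → V, ∀ i, D.Adj (l i) x ∧ D.Adj (l i) (y i) ∧ D.Adj (y i) (l (i + 1)) := by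
  have exists_low (i : ZMod 3) : ∃ b, D.Adj b x ∧ D.Adj b (y i) ∧ D.Adj (y (i + 2)) b := by
    obtain ⟨z, hz, rfl, hzy⟩ := h.exists_triangle_forall_adj ha hD (hy.adj i)
    have h1 : z 1 = y (i + 2) := h.eq_of_common_mid ha (hz 0) (hy.adj _) (hy.adj i) (hzy 1)
      (hy.isTriangle.adj_add_two i)
    exact ⟨z 2, hz 2, hzy 2, h1 ▸ hz 1⟩
  choose l hlx hly hyl using exists_low
  refine ⟨l, fun i => ⟨hlx i, hly i, ?_⟩⟩
  have hi : i + 1 + 2 = i := by rw [add_right_comm, zmod_three_add_two_add_one]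
  simpa only [hi] using hyl (i + 1)

theorem IsOutTriangle.exists_lachlanH_hom {x : V} {y : ZMod 3 → V} (hy : IsOutTriangle D x y) :
    Nonempty (lachlanH.Adj →r D.Adj) := by
  obtain ⟨t, hyt⟩ := h.exists_common_out_of_isTriangle ha hD hy.isTriangle
  obtain ⟨l, hl⟩ := hy.exists_lower ha h hD
  choose hlx hly hyl using hl
  have htl (i : ZMod 3) : D.Adj t (l i) := by
    obtain ⟨i, rfl⟩ := add_right_surjective 1 i
    exact h.adj_of_path ha (hyl i) (hy.isTriangle i) (hyt i) (hly _) (hyt _)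
  have hll (i : ZMod 3) : D.Adj (l i) (l (i + 1)) := by
    have hne : l i ≠ l (i + 1) := fun hi => ha _ _ (hly i) (hi ▸ hyl i)
    refine (h.adj_or_adj (htl i) (htl (i + 1)) hne).resolve_right fun hll => ?_
    have hyl' : D.Adj (y (i + 1)) (l i) :=
      h.adj_of_path ha hll (hlx _) (hly _) (hlx i) (hy.adj _)
    have hyl'' : D.Adj (y (i + 2)) (l i) := by
      simpa only [zmod_three_add_two_add_one] using hyl (i + 2)
    have hy12 : D.Adj (y (i + 1)) (y (i + 2)) := by
      simpa only [add_assoc, one_add_one_eq_two] using hy.isTriangle (i + 1)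
    exact ne_of_adj ha (htl i) (h.eq_of_common_out ha hy12 (hyt _) hyl' (hyt _) hyl'')
  let g : LachlanVertex → V
    | .north => x
    | .south => t
    | .upper i => y i
    | .lower i => l i
  refine ⟨g, ?_⟩
  rintro (_ | _ | i | i) (_ | _ | j | j) hij <;> simp only [lachlanH] at hij <;> try subst hij
  exacts [hy.adj j, htl j, hyt i, hy.isTriangle i, hyl i, hlx i, hly j, hll i]

omit ha h hD

theorem lachlanH_exists_triangle (p : LachlanVertex) :
    ∃ z, IsTriangle lachlanH z ∧ ∀ i, lachlanH.Adj p (z i) := by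
  obtain _ | _ | i | i := p
  · exact ⟨.upper, fun _ => rfl, fun _ => trivial⟩
  · exact ⟨.lower, fun _ => rfl, fun _ => trivial⟩
  · refine ⟨(![.upper (i + 1), .south, .lower (i + 1)] : Fin 3 → _), fun j => ?_, fun j => ?_⟩ <;>
      fin_cases j
    exacts [trivial, trivial, rfl, rfl, trivial, rfl]
  · refine ⟨(![.north, .upper i, .lower (i + 1)] : Fin 3 → _), fun j => ?_, fun j => ?_⟩ <;>
      fin_cases j
    exacts [trivial, rfl, trivial, trivial, rfl, rfl]

theorem lachlanH_eq_or_adj_or_path (p q : LachlanVertex) :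
    p = q ∨ lachlanH.Adj p q ∨ lachlanH.Adj q p ∨ ∃ r, lachlanH.Adj p r ∧ lachlanH.Adj r q := by
  obtain _ | _ | i | i := p <;> obtain _ | _ | j | j := q
  case north.north | south.south => exact .inl rfl
  case north.upper | upper.south | south.lower | lower.north => exact .inr (.inl trivial)
  case upper.north | south.upper | lower.south | north.lower => exact .inr (.inr (.inl trivial))
  case north.south => exact .inr (.inr (.inr ⟨.upper 0, trivial, trivial⟩))
  case south.north => exact .inr (.inr (.inr ⟨.lower 0, trivial, trivial⟩))
  case upper.upper | lower.lower =>
    obtain rfl | rfl | rfl := zmod_three_cases i j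
    exacts [.inl rfl, .inr (.inl rfl), .inr (.inr (.inl (zmod_three_add_two_add_one i).symm))]
  case upper.lower =>
    obtain rfl | rfl | rfl := zmod_three_cases i j
    exacts [.inr (.inr (.inl rfl)), .inr (.inl rfl),
      .inr (.inr (.inr ⟨.upper (i + 1), rfl, (add_assoc i 1 1).symm⟩))]
  case lower.upper =>
    obtain rfl | rfl | rfl := zmod_three_cases i j
    exacts [.inr (.inl rfl), .inr (.inr (.inr ⟨.upper i, rfl, rfl⟩)),
      .inr (.inr (.inl (zmod_three_add_two_add_one i).symm))]

include ha h hD in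
theorem HasOutTriangles.nonempty_iso_lachlanH (hconn : D.IsConnected) :
    Nonempty (Iso D lachlanH) := by
  obtain ⟨⟨x⟩, -⟩ := isConnected_iff_eqvGen.1 hconn
  obtain ⟨y, hy⟩ := h x
  obtain ⟨g⟩ := hy.exists_lachlanH_hom ha h hD
  have hinj : Function.Injective g := fun p q hpq => by
    obtain hpq' | hadj | hadj | ⟨r, hpr, hrq⟩ := lachlanH_eq_or_adj_or_path p q
    · exact hpq'
    · exact (ne_of_adj ha (g.map_rel hadj) hpq).elim
    · exact (ne_of_adj ha (g.map_rel hadj) hpq.symm).elim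
    · exact (ha _ _ (g.map_rel hpr) (hpq ▸ g.map_rel hrq)).elim
  have hout (p : LachlanVertex) (v : V) (hv : D.Adj (g p) v) : ∃ q, lachlanH.Adj p q ∧ g q = v := by
    obtain ⟨z, hz, hpz⟩ := lachlanH_exists_triangle p
    obtain ⟨i, rfl⟩ :=
      (((hz.map g).isOutTriangle ha h fun i => g.map_rel (hpz i)).adj_iff v).1 hv
    exact ⟨z i, hpz i, rfl⟩
  have hcyc (u v : V) (huv : D.Adj u v) : ReflTransGen D.Adj v u := by
    obtain ⟨z, hz, rfl, rfl⟩ := h.exists_triangle_of_adj ha hD huv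
    exact .tail (.single (hz 1)) (hz 2)
  have hsurj : Function.Surjective g := by
    refine Set.range_eq_univ.1 (eq_univ_of_outClosed hconn hcyc ⟨_, .north, rfl⟩ ?_)
    rintro _ ⟨p, rfl⟩ v hv
    obtain ⟨q, -, hq⟩ := hout p v hv
    exact ⟨q, hq⟩
  refine ⟨RelIso.symm ⟨.ofBijective g ⟨hinj, hsurj⟩, fun {p q} => ⟨fun hpq => ?_, g.map_rel⟩⟩⟩
  obtain ⟨r, hpr, hrq⟩ := hout p _ hpq
  exact hinj hrq ▸ hpr

end OutTriangles

/-! ### Blow-ups of the directed triangle as out-neighbourhoods -/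

/-- The out-neighbourhood of `x` is `C₃[K̄ₙ]`, the vertex `(i, a)` being placed at `f i a`. -/
structure IsOutChart (D : Digraph V) (x : V) {n : ℕ} (f : ZMod 3 → Fin n → V) : Prop where
  injective : ∀ i, Function.Injective (f i)
  adj_iff : ∀ u, D.Adj x u ↔ ∃ i a, f i a = u
  adj_apply_iff : ∀ i j a b, D.Adj (f i a) (f j b) ↔ j = i + 1

variable {n : ℕ}

theorem exists_isOutChart {x : V}
    (e : Iso (D.inducedOn (D.outNbhd x)) ((directedCycle 3).lexProduct (edgeless n))) :
    ∃ f : ZMod 3 → Fin n → V, IsOutChart D x f := by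
  refine ⟨fun i a => (e.symm (i, a)).1, fun i a b hab => ?_, fun u => ⟨fun hu => ?_, ?_⟩,
    fun i j a b => ?_⟩
  · exact congrArg Prod.snd (e.symm.injective (Subtype.ext hab))
  · exact ⟨_, _, congrArg Subtype.val (e.symm_apply_apply ⟨u, hu⟩)⟩
  · rintro ⟨i, a, rfl⟩
    exact (e.symm (i, a)).2
  · exact e.symm.map_rel_iff.trans lexProduct_edgeless_adj

theorem IsOutChart.map {x : V} {f : ZMod 3 → Fin n → V} (hf : IsOutChart D x f) (α : Iso D E) :
    IsOutChart E (α x) fun i a => α (f i a) := by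
  refine ⟨fun i => α.injective.comp (hf.injective i), α.surjective.forall.2 fun u => ?_,
    fun i j a b => α.map_rel_iff.trans (hf.adj_apply_iff i j a b)⟩
  simp only [α.injective.eq_iff, α.map_rel_iff, hf.adj_iff]

theorem IsOutChart.adj {x : V} {f : ZMod 3 → Fin n → V} (hf : IsOutChart D x f) (i : ZMod 3)
    (a : Fin n) : D.Adj x (f i a) :=
  (hf.adj_iff _).2 ⟨i, a, rfl⟩

/-- The out-neighbours of `x` that are not adjacent to `z`. If `z` is an out-neighbour of `x` and
the out-neighbourhood of `x` is `C₃[K̄ₙ]`, this is the part of `C₃[K̄ₙ]` containing `z`. -/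
def outPart (D : Digraph V) (x z : V) : Set V :=
  {w | D.Adj x w ∧ ¬ D.Adj w z ∧ ¬ D.Adj z w}

theorem mem_outPart_comm {x z w : V} (hxz : D.Adj x z) (hw : w ∈ outPart D x z) :
    z ∈ outPart D x w :=
  ⟨hxz, hw.2.2, hw.2.1⟩

theorem image_outPart (α : Iso D E) (x z : V) :
    α '' outPart D x z = outPart E (α x) (α z) := by
  ext w
  obtain ⟨u, rfl⟩ := α.surjective w
  rw [α.injective.mem_set_image]
  simp only [outPart, Set.mem_ofPred_eq, α.map_rel_iff]

theorem IsOutChart.outPart_apply {x : V} {f : ZMod 3 → Fin n → V} (hf : IsOutChart D x f)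
    (i : ZMod 3) (a : Fin n) : outPart D x (f i a) = Set.range (f i) := by
  have zmod_three_eq_iff : ∀ j, i ≠ j + 1 ∧ j ≠ i + 1 ↔ j = i := by
    revert i; decide
  ext w
  refine ⟨fun ⟨hw, hwz, hzw⟩ => ?_, ?_⟩
  · obtain ⟨j, b, rfl⟩ := (hf.adj_iff w).1 hw
    rw [hf.adj_apply_iff] at hwz hzw
    obtain rfl := (zmod_three_eq_iff j).1 ⟨hwz, hzw⟩
    exact ⟨b, rfl⟩
  · rintro ⟨b, rfl⟩
    refine ⟨hf.adj i b, ?_⟩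
    simp only [hf.adj_apply_iff, left_eq_add, one_ne_zero, not_false_eq_true, and_self]

/-- All out-neighbourhoods are `C₃[K̄ₙ]`. -/
def HasOutCharts (D : Digraph V) (n : ℕ) : Prop :=
  ∀ x, ∃ f : ZMod 3 → Fin n → V, IsOutChart D x f

section OutCharts

variable (h : HasOutCharts D n)

include h

theorem HasOutCharts.encard_outPart {x z : V} (hxz : D.Adj x z) : (outPart D x z).encard = n := by
  obtain ⟨f, hf⟩ := h x
  obtain ⟨i, a, rfl⟩ := (hf.adj_iff z).1 hxz
  rw [hf.outPart_apply, ← Set.image_univ, (hf.injective i).encard_image, Set.encard_univ,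
    ENat.card_eq_coe_fintype_card, Fintype.card_fin]

theorem HasOutCharts.outPart_eq_singleton [Subsingleton (Fin n)] {x z : V} (hxz : D.Adj x z) :
    outPart D x z = {z} := by
  obtain ⟨f, hf⟩ := h x
  obtain ⟨i, a, rfl⟩ := (hf.adj_iff z).1 hxz
  rw [hf.outPart_apply]
  exact (Set.subsingleton_range _).eq_singleton_of_mem ⟨a, rfl⟩

theorem HasOutCharts.outPart_adj_congr {x z w v : V} (hxz : D.Adj x z) (hw : w ∈ outPart D x z)
    (hxv : D.Adj x v) : (D.Adj z v ↔ D.Adj w v) ∧ (D.Adj v z ↔ D.Adj v w) := by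
  obtain ⟨f, hf⟩ := h x
  obtain ⟨i, a, rfl⟩ := (hf.adj_iff z).1 hxz
  obtain ⟨j, b, rfl⟩ := (hf.adj_iff v).1 hxv
  rw [hf.outPart_apply] at hw
  obtain ⟨c, rfl⟩ := hw
  simp only [hf.adj_apply_iff, and_self]

theorem HasOutCharts.outPart_eq_of_adj {x y z : V} (hxy : D.Adj x y) (hxz : D.Adj x z)
    (hyz : D.Adj y z) : outPart D x z = outPart D y z :=
  (Set.finite_of_encard_eq_coe (h.encard_outPart hyz)).eq_of_subset_of_encard_le'
    (fun _ hw => ⟨(h.outPart_adj_congr hxz hw hxy).2.1 hyz, hw.2⟩)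
    ((h.encard_outPart hyz).trans (h.encard_outPart hxz).symm).le

variable (ha : D.Asymmetric) (hD : D.IsCHomogeneous)

include ha hD

/-- By homogeneity, two non-adjacent in-neighbours of `z` can be moved to two vertices in a part of
some `C₃[K̄ₙ]` in which `z` lies in the next part. -/
theorem HasOutCharts.outPart_eq {x x' z : V} (hxz : D.Adj x z) (hx'z : D.Adj x' z) :
    outPart D x z = outPart D x' z := by
  by_cases hxx' : D.Adj x x'
  · exact h.outPart_eq_of_adj hxx' hxz hx'z
  by_cases hx'x : D.Adj x' x
  · exact (h.outPart_eq_of_adj hx'x hx'z hxz).symm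
  by_cases hne : x = x'
  · rw [hne]
  rcases subsingleton_or_nontrivial (Fin n) with _ | _
  · rw [h.outPart_eq_singleton hxz, h.outPart_eq_singleton hx'z]
  obtain ⟨f, hf⟩ := h x
  obtain ⟨i, a, rfl⟩ := (hf.adj_iff z).1 hxz
  obtain ⟨b, b', hb⟩ := exists_pair_ne (Fin n)
  have hadj (c : Fin n) : D.Adj (f (i + 2) c) (f i a) :=
    (hf.adj_apply_iff _ _ _ _).2 (zmod_three_add_two_add_one i).symm
  have hnadj (c c' : Fin n) : ¬ D.Adj (f (i + 2) c) (f (i + 2) c') := by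
    simp only [hf.adj_apply_iff, left_eq_add, one_ne_zero, not_false_eq_true]
  have hpart (c : Fin n) : outPart D (f (i + 2) c) (f i a) = outPart D x (f i a) :=
    (h.outPart_eq_of_adj (hf.adj _ _) hxz (hadj c)).symm
  obtain ⟨α, hαx, hαx', hαz⟩ := exists_aut_inFork ha hD
    ⟨hadj b, hadj b', fun hbb' => hb (hf.injective _ hbb'), hnadj b b', hnadj b' b⟩
    ⟨hxz, hx'z, hne, hxx', hx'x⟩
  calc outPart D x (f i a) = α '' outPart D (f (i + 2) b) (f i a) := by rw [image_outPart, hαx, hαz]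
    _ = α '' outPart D (f (i + 2) b') (f i a) := by rw [hpart, hpart]
    _ = outPart D x' (f i a) := by rw [image_outPart, hαx', hαz]

theorem HasOutCharts.exists_common_in {z v : V} (hzv : D.Adj z v) :
    ∃ x, D.Adj x z ∧ D.Adj x v := by
  obtain ⟨f, hf⟩ := h z
  obtain ⟨-, a, -⟩ := (hf.adj_iff v).1 hzv
  obtain ⟨α, hαz, hαv⟩ := exists_aut_edge ha hD ((hf.adj_apply_iff 0 1 a a).2 rfl) hzv
  have hz := α.map_rel_iff.2 (hf.adj 0 a)
  have hv := α.map_rel_iff.2 (hf.adj 1 a)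
  exact ⟨α z, by rwa [hαz] at hz, by rwa [hαv] at hv⟩

theorem HasOutCharts.mem_outPart_iff_twinSetoid {x z w : V} (hxz : D.Adj x z) :
    w ∈ outPart D x z ↔ twinSetoid D w z := by
  have adj_of_mem {z w : V} (hxz : D.Adj x z) (hw : w ∈ outPart D x z) (v : V) :
      (D.Adj z v → D.Adj w v) ∧ (D.Adj v z → D.Adj v w) := by
    refine ⟨fun hzv => ?_, fun hvz => ?_⟩
    · obtain ⟨x', hx'z, hx'v⟩ := h.exists_common_in ha hD hzv
      rw [h.outPart_eq ha hD hxz hx'z] at hw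
      exact (h.outPart_adj_congr hx'z hw hx'v).1.1 hzv
    · rw [h.outPart_eq ha hD hxz hvz] at hw
      exact hw.1
  refine ⟨fun hw v => ?_, fun hw => ?_⟩
  · have hwz := adj_of_mem hxz hw v
    have hzw := adj_of_mem hw.1 (mem_outPart_comm hxz hw) v
    exact ⟨⟨hzw.1, hwz.1⟩, ⟨hzw.2, hwz.2⟩⟩
  · exact ⟨(hw x).2.2 hxz, mt (hw z).1.1 (not_adj_self ha z), mt (hw z).2.1 (not_adj_self ha z)⟩

variable [NeZero n]

theorem HasOutCharts.exists_range_eq_twins (z : V) :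
    ∃ f : Fin n → V, Function.Injective f ∧ ∀ w, twinSetoid D w z ↔ w ∈ Set.range f := by
  obtain ⟨f, hf⟩ := h z
  obtain ⟨α, hα⟩ := exists_aut_vertex ha hD (f 0 0) z
  have hxz : D.Adj (α z) z := by
    simpa only [hα] using α.map_rel_iff.2 (hf.adj 0 0)
  obtain ⟨f', hf'⟩ := h (α z)
  obtain ⟨i, a, hia⟩ := (hf'.adj_iff z).1 hxz
  refine ⟨f' i, hf'.injective i, fun w => ?_⟩
  rw [← h.mem_outPart_iff_twinSetoid ha hD hxz, ← hf'.outPart_apply i a, hia]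

theorem HasOutCharts.hasOutTriangles_twinQuotient : HasOutTriangles (twinQuotient D) := by
  rintro ⟨x⟩
  obtain ⟨f, hf⟩ := h x
  refine ⟨fun i => .mk _ (f i 0), fun i => (hf.adj_apply_iff i _ 0 0).2 rfl, ?_⟩
  rintro ⟨u⟩
  refine ⟨fun hu => ?_, fun ⟨i, hi⟩ => hi ▸ hf.adj i 0⟩
  obtain ⟨i, a, rfl⟩ := (hf.adj_iff u).1 hu
  refine ⟨i, Quotient.sound ((h.mem_outPart_iff_twinSetoid ha hD hu).1 ?_)⟩
  exact (hf.outPart_apply i a).symm ▸ ⟨0, rfl⟩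

end OutCharts

theorem nonempty_iso_of_outNbhd [NeZero n] (ha : D.Asymmetric) (hconn : D.IsConnected)
    (hD : D.IsCHomogeneous) {x : V}
    (e : Iso (D.inducedOn (D.outNbhd x)) ((directedCycle 3).lexProduct (edgeless n))) :
    Nonempty (Iso D (lachlanH.lexProduct (edgeless n))) := by
  obtain ⟨f, hf⟩ := exists_isOutChart e
  have h : HasOutCharts D n := fun y => by
    obtain ⟨α, rfl⟩ := exists_aut_vertex ha hD x y
    exact ⟨_, hf.map α⟩
  obtain ⟨φ⟩ := nonempty_iso_twinQuotient_lexProduct (h.exists_range_eq_twins ha hD)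
  obtain ⟨ψ⟩ := (h.hasOutTriangles_twinQuotient ha hD).nonempty_iso_lachlanH
    (asymmetric_twinQuotient ha) (isCHomogeneous_twinQuotient hD) (isConnected_twinQuotient hconn)
  exact ⟨φ.trans (lexProductCongrLeft ψ _)⟩

theorem nonempty_iso_of_inNbhd [NeZero n] (ha : D.Asymmetric) (hconn : D.IsConnected)
    (hD : D.IsCHomogeneous) {x : V}
    (e : Iso (D.inducedOn (D.inNbhd x)) ((directedCycle 3).lexProduct (edgeless n))) :
    Nonempty (Iso D (lachlanH.lexProduct (edgeless n))) := by
  have e' : Iso ((reverse D).inducedOn ((reverse D).outNbhd x))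
      (reverse ((directedCycle 3).lexProduct (edgeless n))) := reverseIso e
  rw [reverse_lexProduct_edgeless] at e'
  obtain ⟨φ⟩ := nonempty_iso_of_outNbhd (asymmetric_reverse ha) (isConnected_reverse hconn)
    (isCHomogeneous_reverse hD) (e'.trans (lexProductCongrLeft directedTriangleReverseIso _))
  have φ' : Iso D (reverse (lachlanH.lexProduct (edgeless n))) := reverseIso φ
  rw [reverse_lexProduct_edgeless] at φ'
  exact ⟨φ'.trans (lexProductCongrLeft lachlanHReverseIso _)⟩

end LachlanDigraph

theorem lemma3p9_general {V : Type*} (D : Digraph V)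
    (hasymm : D.Asymmetric) (hconn : D.IsConnected)
    (hhom : D.IsCHomogeneous)
    (n : ℕ) (hn : 1 ≤ n) (x : V)
    (hx : Nonempty (Digraph.Iso (D.inducedOn (D.outNbhd x))
              (Digraph.lexProduct (Digraph.directedCycle 3) (Digraph.edgeless n))) ∨
          Nonempty (Digraph.Iso (D.inducedOn (D.inNbhd x))
              (Digraph.lexProduct (Digraph.directedCycle 3) (Digraph.edgeless n)))) :
    Nonempty (Digraph.Iso D (Digraph.lexProduct Digraph.lachlanH (Digraph.edgeless n))) := by
  have : NeZero n := ⟨Nat.one_le_iff_ne_zero.1 hn⟩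
  rcases hx with ⟨⟨e⟩⟩ | ⟨⟨e⟩⟩
  · exact LachlanDigraph.nonempty_iso_of_outNbhd hasymm hconn hhom e
  · exact LachlanDigraph.nonempty_iso_of_inNbhd hasymm hconn hhom e

theorem lemma3p9 {V : Type*} (D : Digraph V)
    (hasymm : D.Asymmetric) (hconn : D.IsConnected)
    (hfin : D.IsLocallyFinite) (hhom : D.IsCHomogeneous)
    (n : ℕ) (hn : 1 ≤ n) (x : V)
    (hx : Nonempty (Digraph.Iso (D.inducedOn (D.outNbhd x))
              (Digraph.lexProduct (Digraph.directedCycle 3) (Digraph.edgeless n))) ∨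
          Nonempty (Digraph.Iso (D.inducedOn (D.inNbhd x))
              (Digraph.lexProduct (Digraph.directedCycle 3) (Digraph.edgeless n)))) :
    Nonempty (Digraph.Iso D (Digraph.lexProduct Digraph.lachlanH (Digraph.edgeless n))) := by
  exact lemma3p9_general D hasymm hconn hhom n hn x hx
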